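/- Let $p$ be a prime and $G$ a finite $p$-group of order $p^n$, $n\ge 3$, of maximal class (that is, of nilpotency class $n-1$). For a complex irreducible character $\chi$ of $G$ put $\operatorname{cod}(\chi)=|G:\ker\chi|/\chi(1)$, and let $\operatorname{cod}(G)$ be the set of all codegrees $\operatorname{cod}(\chi)$, $\chi\in\operatorname{Irr}(G)$. Suppose that $G$ is normally monomial, i.e. every $\chi\in\operatorname{Irr}(G)$ is induced from a linear character of some normal subgroup of $G$. Then the largest degree $\max\{\chi(1):\chi\in\operatorname{Irr}(G)\}$ is $p^b$ for some integer $b\ge 0$, and $\operatorname{cod}(G)=\{p^i : 0\le i\le c\}$ for some integer $c\ge n-b$. -/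

import Mathlib

noncomputable section

/-- `Irr(G)`: the set of complex irreducible characters of `G`, i.e. the functions `G → ℂ` afforded
by an irreducible representation of `G` on some `ℂ^d`. -/
def irrCharacters (G : Type*) [Group G] : Set (G → ℂ) :=
  {χ | ∃ (d : ℕ) (ρ : Representation ℂ G (Fin d → ℂ)), ρ.IsIrreducible ∧ χ = ρ.character}

/-- `cd(G) = {χ(1) | χ ∈ Irr(G)}`, as a set of natural numbers. -/
def characterDegrees (G : Type*) [Group G] : Set ℕ :=
  {d | ∃ χ ∈ irrCharacters G, χ 1 = (d : ℂ)}

/-- The kernel `{g | χ(g) = χ(1)}` of a character `χ`. -/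
def characterKernel {G : Type*} [Group G] (χ : G → ℂ) : Set G :=
  {g | χ g = χ 1}

/-- The codegree `|G : ker χ| / χ(1)` of a character `χ` of a finite group `G`, where
`|G : ker χ| = |G| / |ker χ|`. -/
def codegree {G : Type*} [Group G] (χ : G → ℂ) : ℂ :=
  ((Nat.card G : ℂ) / (Nat.card (characterKernel χ) : ℂ)) / χ 1

/-- `cod(G)`: the set of codegrees of the irreducible characters of `G`. -/
def codegrees (G : Type*) [Group G] : Set ℂ :=
  codegree '' irrCharacters G

open Classical in
/-- The induced function `φ^G(g) = |H|⁻¹ ∑_{x ∈ G} φ°(x⁻¹ g x)`, where `φ°` is `φ` on `H` and `0`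
outside `H`. -/
def inducedCharacter {G : Type*} [Group G] [Fintype G] (H : Subgroup G) (φ : H → ℂ) (g : G) : ℂ :=
  (Nat.card H : ℂ)⁻¹ * ∑ x : G, if h : x⁻¹ * g * x ∈ H then φ ⟨x⁻¹ * g * x, h⟩ else 0

/-- `G` is normally monomial: every irreducible character of `G` is induced from a linear character
of a normal subgroup of `G`. -/
def IsNormallyMonomial (G : Type*) [Group G] [Fintype G] : Prop :=
  ∀ χ ∈ irrCharacters G, ∃ (H : Subgroup G) (lam : H →* ℂˣ),
    H.Normal ∧ χ = inducedCharacter H (fun h => (lam h : ℂ))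

end

/-! Let `χ`, with kernel `N`, be induced from a linear character of a normal subgroup `H`. Then `N ≤
H`, and `H / N` is abelian since conjugates of commutators of `H` are again commutators of `H`. An
irreducible representation has degree at most the index of any subgroup acting by commuting
operators, so no abelian subgroup of `G / N` is larger than `H / N`. Hence `cod χ = |H : N|` is the
largest order of an abelian subgroup of `G / N`, and depends on `N` only (`characterKernel_eq_ker`).

In maximal class, a normal subgroup not containing `G'` is a term `γ k` of the lower central series,
indexed from `γ 0 = G`, with `2 ≤ k ≤ n - 1` (`exists_eq_lowerCentralSeries`); each such term is a
kernel. Let `p ^ e k` be the resulting codegree. Then `e 2 = 2` and `e (k + 1) ≤ e k + 1`, so `e`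
takes every value from 2 to its maximum `c`. Kernels containing `G'` give codegrees dividing `p ^
2`, and 1 and `p` both occur. A faithful character, of degree at most `p ^ b`, has codegree at least
`p ^ (n - b)`, so `c ≥ n - b`. -/

open Module
open scoped commutatorElement

/-! ### Irreducible representations: degree bound, existence and kernels -/

namespace Representation

theorem isIrreducible_iff_forall_invariant {k G V : Type*} [Field k] [Monoid G] [AddCommGroup V]
    [Module k V] (ρ : Representation k G V) :
    ρ.IsIrreducible ↔ Nontrivial V ∧ ∀ W : Submodule k V,
      (∀ g, ∀ v ∈ W, ρ g v ∈ W) → W = ⊥ ∨ W = ⊤ := by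
  constructor
  · intro h
    constructor
    · by_contra hV
      rw [not_nontrivial_iff_subsingleton] at hV
      apply bot_ne_top (α := Subrepresentation ρ)
      apply Subrepresentation.toSubmodule_injective
      exact Subsingleton.elim _ _
    · intro W hW
      rcases h.eq_bot_or_eq_top ⟨W, hW⟩ with h | h
      · exact .inl congr(Subrepresentation.toSubmodule $h)
      · exact .inr congr(Subrepresentation.toSubmodule $h)
  · rintro ⟨hV, h⟩
    refine { exists_pair_ne := ⟨⊥, ⊤, fun hbt => ?_⟩, eq_bot_or_eq_top := fun σ => ?_ }
    · exact bot_ne_top (α := Submodule k V) congr(Subrepresentation.toSubmodule $hbt)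
    · rcases h σ.toSubmodule σ.apply_mem_toSubmodule with h | h
      · exact .inl (Subrepresentation.toSubmodule_injective h)
      · exact .inr (Subrepresentation.toSubmodule_injective h)

/-- A representation transported along a linear equivalence. -/
def transport {k G V W : Type*} [Field k] [Monoid G] [AddCommGroup V] [Module k V]
    [AddCommGroup W] [Module k W] (ρ : Representation k G V) (e : V ≃ₗ[k] W) :
    Representation k G W where
  toFun g := e.conj (ρ g)
  map_one' := by ext; simp
  map_mul' a b := by ext; simp [LinearEquiv.conj_apply]

@[simp]
theorem transport_apply {k G V W : Type*} [Field k] [Monoid G] [AddCommGroup V] [Module k V]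
    [AddCommGroup W] [Module k W] (ρ : Representation k G V) (e : V ≃ₗ[k] W) (g : G) (w : W) :
    ρ.transport e g w = e (ρ g (e.symm w)) := rfl

theorem IsIrreducible.transport {k G V W : Type*} [Field k] [Monoid G] [AddCommGroup V]
    [Module k V] [AddCommGroup W] [Module k W] {ρ : Representation k G V} (h : ρ.IsIrreducible)
    (e : V ≃ₗ[k] W) : (ρ.transport e).IsIrreducible := by
  rw [isIrreducible_iff_forall_invariant] at h ⊢
  obtain ⟨hV, h⟩ := h
  refine ⟨e.symm.toEquiv.nontrivial, fun U hU => ?_⟩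
  have key : U = (U.comap e.toLinearMap).map e.toLinearMap :=
    (Submodule.map_comap_eq_of_surjective e.surjective U).symm
  rcases h (U.comap e.toLinearMap) (fun g v hv => by simpa using hU g _ hv) with h | h
  · left; rw [key, h, Submodule.map_bot]
  · right; rw [key, h, Submodule.map_top, LinearEquiv.range]

theorem isIrreducible_of_isAtom {k G V : Type*} [Field k] [Monoid G] [AddCommGroup V]
    [Module k V] {ρ : Representation k G V} {σ : Subrepresentation ρ} (hσ : IsAtom σ) :
    σ.toRepresentation.IsIrreducible := by
  rw [isIrreducible_iff_forall_invariant]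
  constructor
  · rw [Submodule.nontrivial_iff_ne_bot]
    intro h
    exact hσ.1 (Subrepresentation.toSubmodule_injective h)
  · intro W hW
    let τ : Subrepresentation ρ := ⟨W.map σ.toSubmodule.subtype, by
      rintro g _ ⟨w, hw, rfl⟩
      exact ⟨_, hW g w hw, rfl⟩⟩
    have hτ : τ ≤ σ := by
      rintro _ ⟨w, hw, rfl⟩
      exact w.2
    rcases hσ.le_iff.1 hτ with h | h
    · left
      have h' : W.map σ.toSubmodule.subtype = ⊥ := congr(Subrepresentation.toSubmodule $h)
      rw [eq_bot_iff]
      intro w hw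
      have hw' : (w : V) ∈ W.map σ.toSubmodule.subtype := ⟨w, hw, rfl⟩
      rw [h', Submodule.mem_bot] at hw'
      exact (Submodule.mem_bot k).2 (Subtype.ext hw')
    · right
      have h' : W.map σ.toSubmodule.subtype = σ.toSubmodule :=
        congr(Subrepresentation.toSubmodule $h)
      rw [eq_top_iff]
      intro w _
      have hw : (w : V) ∈ W.map σ.toSubmodule.subtype := h'.symm.le w.2
      obtain ⟨u, hu, huw⟩ := hw
      rwa [← Subtype.ext huw]

theorem exists_isAtom_le {k G V : Type*} [Field k] [Monoid G] [AddCommGroup V]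
    [Module k V] [FiniteDimensional k V] {ρ : Representation k G V} (τ : Subrepresentation ρ)
    (hτ : τ ≠ ⊥) : ∃ σ ≤ τ, IsAtom σ := by
  have : WellFoundedLT (Subrepresentation ρ) :=
    StrictMono.wellFoundedLT (f := Subrepresentation.toSubmodule (ρ := ρ)) fun _ _ h => h
  obtain ⟨σ, hσ, h⟩ := (IsAtomic.eq_bot_or_exists_atom_le τ).resolve_left hτ
  exact ⟨σ, h, hσ⟩

/-- On an irreducible subrepresentation each `ρ g` is an intertwining map, hence a scalar by Schur's
lemma. -/
theorem exists_common_eigenvector {k G V : Type*} [Field k] [IsAlgClosed k] [Monoid G]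
    [AddCommGroup V] [Module k V] [FiniteDimensional k V] [Nontrivial V]
    (ρ : Representation k G V) (hcomm : ∀ a b, Commute (ρ a) (ρ b)) :
    ∃ v : V, v ≠ 0 ∧ ∀ g, ∃ c : k, ρ g v = c • v := by
  obtain ⟨σ, -, hσ⟩ := exists_isAtom_le (⊤ : Subrepresentation ρ) (by
    intro h
    exact top_ne_bot (α := Submodule k V) congr(Subrepresentation.toSubmodule $h))
  have hirr := isIrreducible_of_isAtom hσ
  obtain ⟨⟨v, hv0⟩⟩ : Nonempty {v : σ.toSubmodule // v ≠ 0} := by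
    have := ((isIrreducible_iff_forall_invariant _).1 hirr).1
    exact ⟨exists_ne 0 |>.choose, exists_ne 0 |>.choose_spec⟩
  refine ⟨v, by simpa using hv0, fun g => ?_⟩
  let f : IntertwiningMap σ.toRepresentation σ.toRepresentation :=
    ⟨σ.toRepresentation g, fun a => by
      ext x
      exact congr($(hcomm g a) (x : V))⟩
  obtain ⟨c, hc⟩ := (IsIrreducible.algebraMap_intertwiningMap_bijective_of_isAlgClosed
    (ρ := σ.toRepresentation)).2 f
  refine ⟨c, ?_⟩
  have h1 : f v = c • v := by rw [← hc]; rfl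
  exact congr(($h1 : V)).trans rfl

/-- The translates of a common eigenvector of `K` by coset representatives span an invariant
subspace, which must be everything. -/
theorem IsIrreducible.finrank_le_index {k G V : Type*} [Field k] [IsAlgClosed k] [Group G]
    [AddCommGroup V] [Module k V] [FiniteDimensional k V] {ρ : Representation k G V}
    (h : ρ.IsIrreducible) (K : Subgroup G) [K.FiniteIndex]
    (hcomm : ∀ a ∈ K, ∀ b ∈ K, Commute (ρ a) (ρ b)) : finrank k V ≤ K.index := by
  obtain ⟨hV, h⟩ := (isIrreducible_iff_forall_invariant ρ).1 h
  obtain ⟨v, hv0, hv⟩ := exists_common_eigenvector (ρ.comp K.subtype)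
    (fun a b => hcomm a a.2 b b.2)
  have : Fintype (G ⧸ K) := Fintype.ofFinite _
  let f : G ⧸ K → V := fun q => ρ q.out v
  have hf : ∀ g, ρ g v ∈ Submodule.span k (Set.range f) := by
    intro g
    obtain ⟨κ, hκ⟩ := QuotientGroup.mk_out_eq_mul K g
    obtain ⟨c, hc⟩ := hv κ⁻¹
    have : ρ g v = c • f (g : G ⧸ K) := by
      have hg : g = (g : G ⧸ K).out * ((κ⁻¹ : K) : G) := by rw [hκ]; simp
      conv_lhs => rw [hg]
      rw [map_mul, Module.End.mul_apply]
      erw [hc]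
      rw [map_smul]
    rw [this]
    exact Submodule.smul_mem _ _ (Submodule.subset_span ⟨_, rfl⟩)
  have htop : Submodule.span k (Set.range f) = ⊤ := by
    refine (h _ fun g w hw => ?_).resolve_left fun hbot => hv0 ?_
    · induction hw using Submodule.span_induction with
      | mem x hx =>
        obtain ⟨q, rfl⟩ := hx
        rw [← Module.End.mul_apply, ← map_mul]
        exact hf _
      | zero => simp
      | add x y _ _ hx hy => rw [map_add]; exact add_mem hx hy
      | smul c x _ hx => rw [map_smul]; exact Submodule.smul_mem _ _ hx
    · have := hf 1
      rw [hbot, Submodule.mem_bot] at this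
      simpa using this
  have h1 := finrank_range_le_card (R := k) f
  rwa [Set.finrank, htop, finrank_top, ← Nat.card_eq_fintype_card] at h1

/-- In the permutation module on `G ⧸ N`, the `M`-fixed vectors form a proper subrepresentation. By
Maschke it has a complement, and `M` acts nontrivially on any simple submodule of that complement.
-/
theorem exists_isIrreducible_of_not_le {k G : Type*} [Field k] [CharZero k] [Group G] [Finite G]
    (N M : Subgroup G) [N.Normal] [M.Normal] (hMN : ¬ M ≤ N) :
    ∃ (d : ℕ) (ρ : Representation k G (Fin d → k)), ρ.IsIrreducible ∧
      N ≤ ρ.ker ∧ ¬ M ≤ ρ.ker := by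
  let π : Representation k G (MonoidAlgebra k (G ⧸ N)) := Representation.ofMulAction k G (G ⧸ N)
  have hπ : ∀ g ∈ N, π g = 1 := by
    intro g hg
    refine MonoidAlgebra.lhom_ext' fun x => LinearMap.ext_ring ?_
    induction x using QuotientGroup.induction_on with
    | H x =>
      have : g • (x : G ⧸ N) = x := by
        rw [MulAction.Quotient.smul_coe, QuotientGroup.eq]
        simpa [mul_assoc] using (‹N.Normal›.conj_mem _ (inv_mem hg) x⁻¹)
      simp [π, Representation.ofMulAction_single, this]
  have : FiniteDimensional k (MonoidAlgebra k (G ⧸ N)) :=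
    Module.Finite.equiv (MonoidAlgebra.coeffLinearEquiv k).symm
  let F : Subrepresentation π := ⟨⨅ m : M, LinearMap.ker (π m - 1), by
    intro g v hv
    simp only [Submodule.mem_iInf, LinearMap.mem_ker, LinearMap.sub_apply, Module.End.one_apply,
      sub_eq_zero] at hv ⊢
    intro m
    have h := hv ⟨g⁻¹ * m * g, by simpa using ‹M.Normal›.conj_mem _ m.2 g⁻¹⟩
    have h2 := congr(π g $h)
    rw [← Module.End.mul_apply, ← map_mul] at h2
    simpa [mul_assoc] using h2⟩
  have hFmem : ∀ v, v ∈ F.toSubmodule ↔ ∀ m ∈ M, π m v = v := by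
    intro v
    simp [F, Submodule.mem_iInf, sub_eq_zero]
  obtain ⟨m, hmM, hmN⟩ := SetLike.not_le_iff_exists.1 hMN
  have hF : F ≠ ⊤ := by
    intro h
    have h1 := (hFmem (MonoidAlgebra.single ((1 : G) : G ⧸ N) 1)).1 (by rw [h]; trivial) m hmM
    rw [Representation.ofMulAction_single] at h1
    have h2 := (MonoidAlgebra.single_left_inj one_ne_zero).1 h1
    rw [MulAction.Quotient.smul_coe, QuotientGroup.eq] at h2
    simp at h2
    exact hmN h2
  obtain ⟨C, hC⟩ := exists_isCompl F
  obtain ⟨σ, hσC, hσ⟩ := exists_isAtom_le C (fun h => hF (by simpa [h] using hC.sup_eq_top))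
  have hirr := isIrreducible_of_isAtom hσ
  let e := (finBasis k σ.toSubmodule).equivFun
  refine ⟨_, σ.toRepresentation.transport e, hirr.transport e, ?_, ?_⟩
  · intro g hg
    rw [MonoidHom.mem_ker]
    refine LinearMap.ext fun w => ?_
    have : σ.toRepresentation g = 1 := by
      refine LinearMap.ext fun w => Subtype.ext ?_
      exact congr($(hπ g hg) (w : MonoidAlgebra k (G ⧸ N)))
    rw [transport_apply, this]
    simp
  · intro hM
    have hσF : σ ≤ F := by
      intro v hv
      refine (hFmem v).2 fun g hg => ?_
      have h1 := MonoidHom.mem_ker.1 (hM hg)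
      have h2 := congr($h1 (e ⟨v, hv⟩))
      rw [transport_apply, LinearEquiv.symm_apply_apply, Module.End.one_apply] at h2
      exact congr(($(e.injective h2) : MonoidAlgebra k (G ⧸ N)))
    exact hσ.1 (le_bot_iff.1 (hC.disjoint hσF hσC))

/-- Averaging over `⟨g⟩` projects onto the fixed vectors, so its trace is their dimension. Assuming
the value on all powers of `g` avoids any eigenvalue argument. -/
theorem eq_one_of_character_pow_eq {k G V : Type*} [Field k] [CharZero k] [Group G] [Finite G]
    [AddCommGroup V] [Module k V] [FiniteDimensional k V] (ρ : Representation k G V) (g : G)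
    (hg : ∀ x ∈ Subgroup.zpowers g, ρ.character x = finrank k V) : ρ g = 1 := by
  classical
  let Z := Subgroup.zpowers g
  let τ : Representation k Z V := ρ.comp Z.subtype
  have : Fintype Z := Fintype.ofFinite _
  have : Invertible (Fintype.card Z : k) := invertibleOfNonzero (by simp)
  have h1 := τ.isProj_averageMap.trace
  have h2 : LinearMap.trace k V τ.averageMap = finrank k V := by
    have : ∀ x : Z, LinearMap.trace k V (τ x) = finrank k V := fun x => hg x x.2
    simp [averageMap, GroupAlgebra.average, map_sum, this]
  rw [h2, Nat.cast_inj] at h1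
  have h3 : τ.invariants = ⊤ := Submodule.eq_top_of_finrank_eq h1.symm
  refine LinearMap.ext fun v => ?_
  have h4 : v ∈ τ.invariants := h3 ▸ Submodule.mem_top
  exact h4 ⟨g, Subgroup.mem_zpowers g⟩

end Representation

/-! ### Values of characters induced from linear ones -/

section Induced

variable {G : Type*} [Group G] [Fintype G]

theorem norm_linearCharacter (H : Subgroup G) (lam : H →* ℂˣ) (h : H) : ‖(lam h : ℂ)‖ = 1 := by
  refine Complex.norm_eq_one_of_pow_eq_one (n := Nat.card H) ?_ Nat.card_pos.ne'
  rw [← Units.val_pow_eq_pow_val, ← map_pow, pow_card_eq_one', map_one, Units.val_one]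

theorem Complex.eq_one_of_sum_eq_card {ι : Type*} [Fintype ι] (f : ι → ℂ) (hf : ∀ i, ‖f i‖ ≤ 1)
    (hsum : ∑ i, f i = Fintype.card ι) (i : ι) : f i = 1 := by
  have hre : ∀ j, 0 ≤ 1 - (f j).re := fun j =>
    sub_nonneg.2 ((Complex.re_le_norm _).trans (hf j))
  have h0 : ∑ j, (1 - (f j).re) = 0 := by
    rw [Finset.sum_sub_distrib, ← Complex.re_sum, hsum]
    simp
  have h1 : (f i).re = 1 := by
    have := (Finset.sum_eq_zero_iff_of_nonneg fun j _ => hre j).1 h0 i (Finset.mem_univ i)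
    linarith
  have h2 : Complex.normSq (f i) ≤ 1 := by
    rw [Complex.normSq_eq_norm_sq]
    exact pow_le_one₀ (norm_nonneg _) (hf i)
  rw [Complex.normSq_apply, h1] at h2
  apply Complex.ext
  · simpa using h1
  · have : (f i).im * (f i).im = 0 := le_antisymm (by linarith) (mul_self_nonneg _)
    simpa using this

/-- Equality case of the triangle inequality: `|G|` terms of norm at most 1 sum to `|G|` only if
each is 1. -/
theorem inducedCharacter_eq_index_iff (H : Subgroup G) (lam : H →* ℂˣ) (g : G) :
    inducedCharacter H (fun h => (lam h : ℂ)) g = H.index ↔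
      ∀ x, ∃ h : x⁻¹ * g * x ∈ H, lam ⟨x⁻¹ * g * x, h⟩ = 1 := by
  classical
  have h3 : (Nat.card H : ℂ) ≠ 0 := Nat.cast_ne_zero.2 Nat.card_pos.ne'
  have hcard : (Fintype.card G : ℂ) = Nat.card H * H.index := by
    rw [← Nat.card_eq_fintype_card, ← H.card_mul_index, Nat.cast_mul]
  rw [inducedCharacter, inv_mul_eq_iff_eq_mul₀ h3, ← hcard]
  constructor
  · intro h x
    have := Complex.eq_one_of_sum_eq_card _ (fun y => ?_) h x
    · split_ifs at this with hx
      · exact ⟨hx, Units.ext this⟩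
      · exact absurd this zero_ne_one
    · split_ifs with hy
      · exact (norm_linearCharacter H lam _).le
      · simp
  · intro h
    rw [Finset.sum_congr rfl fun x _ => ?_, Finset.sum_const, Finset.card_univ, nsmul_eq_mul,
      mul_one]
    obtain ⟨hx, hx'⟩ := h x
    rw [dif_pos hx, hx', Units.val_one]

theorem inducedCharacter_one (H : Subgroup G) (lam : H →* ℂˣ) :
    inducedCharacter H (fun h => (lam h : ℂ)) 1 = H.index := by
  rw [inducedCharacter_eq_index_iff]
  intro x
  have hx : x⁻¹ * 1 * x = 1 := by simp
  have h : x⁻¹ * 1 * x ∈ H := by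
    rw [hx]
    exact H.one_mem
  exact ⟨h, by rw [show (⟨_, h⟩ : H) = 1 from Subtype.ext hx, map_one]⟩

end Induced

/-! ### Codegrees as orders of maximal abelian sections -/

/-- `H / N` is an abelian normal section of `G`, of largest order among the abelian sections with
denominator `N`. -/
structure IsMaxAbelianOver {G : Type*} [Group G] (N H : Subgroup G) : Prop where
  normal : H.Normal
  le : N ≤ H
  commutator_le : ⁅H, H⁆ ≤ N
  relIndex_le : ∀ K : Subgroup G, N ≤ K → ⁅K, K⁆ ≤ N → N.relIndex K ≤ N.relIndex H

theorem characterKernel_eq_ker {G : Type*} [Group G] [Fintype G] (hmon : IsNormallyMonomial G)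
    {d : ℕ} {ρ : Representation ℂ G (Fin d → ℂ)} (hρ : ρ.IsIrreducible) :
    characterKernel ρ.character = ρ.ker ∧
      ∃ H : Subgroup G, ρ.character 1 = H.index ∧ IsMaxAbelianOver ρ.ker H := by
  obtain ⟨H, lam, hH, hχ⟩ := hmon _ ⟨d, ρ, hρ, rfl⟩
  have hone : ρ.character 1 = H.index := by rw [hχ, inducedCharacter_one]
  have hd : finrank ℂ (Fin d → ℂ) = H.index := by
    rw [Representation.char_one] at hone
    exact_mod_cast hone
  have hiff : ∀ g, ρ.character g = H.index ↔
      ∀ x, ∃ h : x⁻¹ * g * x ∈ H, lam ⟨x⁻¹ * g * x, h⟩ = 1 := by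
    rw [hχ]
    exact inducedCharacter_eq_index_iff H lam
  have hker : ∀ g, ρ.character g = H.index ↔ g ∈ ρ.ker := by
    intro g
    refine ⟨fun hg => ?_, fun hg => ?_⟩
    -- The criterion `hiff` passes from `g` to its powers, as `lam` is multiplicative.
    · refine MonoidHom.mem_ker.2 (ρ.eq_one_of_character_pow_eq g fun y hy => ?_)
      rw [hd, hiff]
      rw [hiff] at hg
      intro x
      obtain ⟨hx, hx'⟩ := hg x
      obtain ⟨k, rfl⟩ := hy
      have hk : x⁻¹ * g ^ k * x = (x⁻¹ * g * x) ^ k := by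
        simpa using (conj_zpow (i := k) (a := x⁻¹) (b := g)).symm
      refine ⟨hk ▸ H.zpow_mem hx k, ?_⟩
      have : (⟨x⁻¹ * g ^ k * x, hk ▸ H.zpow_mem hx k⟩ : H) = ⟨x⁻¹ * g * x, hx⟩ ^ k :=
        Subtype.ext hk
      exact this ▸ by rw [map_zpow, hx', one_zpow]
    · rw [← hone, Representation.character, Representation.character, MonoidHom.mem_ker.1 hg,
        ← map_one ρ]
  have hle : ρ.ker ≤ H := by
    intro g hg
    obtain ⟨h, -⟩ := (hiff g).1 ((hker g).2 hg) 1
    simpa using h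
  refine ⟨?_, H, hone, hH, hle, ?_, ?_⟩
  · ext g
    rw [characterKernel, Set.mem_ofPred_eq, hone]
    exact hker g
  · rw [Subgroup.commutator_le]
    intro a ha b hb
    rw [← hker, hiff]
    intro x
    have ha' : x⁻¹ * a * x ∈ H := by simpa using hH.conj_mem a ha x⁻¹
    have hb' : x⁻¹ * b * x ∈ H := by simpa using hH.conj_mem b hb x⁻¹
    have hab : x⁻¹ * ⁅a, b⁆ * x = ⁅x⁻¹ * a * x, x⁻¹ * b * x⁆ := by
      simp only [commutatorElement_def]
      group
    have hmem : x⁻¹ * ⁅a, b⁆ * x ∈ H :=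
      hab ▸ H.mul_mem (H.mul_mem (H.mul_mem ha' hb') (H.inv_mem ha')) (H.inv_mem hb')
    refine ⟨hmem, ?_⟩
    have : (⟨x⁻¹ * ⁅a, b⁆ * x, hmem⟩ : H) = ⁅(⟨_, ha'⟩ : H), (⟨_, hb'⟩ : H)⁆ := Subtype.ext hab
    rw [this, map_commutatorElement, commutatorElement_eq_one_iff_commute]
    exact Commute.all _ _
  · intro K hNK hK
    have h1 : H.index ≤ K.index := by
      rw [← hd]
      refine hρ.finrank_le_index K fun a ha b hb => ?_
      have := MonoidHom.mem_ker.1 (hK (Subgroup.commutator_mem_commutator ha hb))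
      have h2 : ⁅a, b⁆ * (b * a) = a * b := by simp [commutatorElement_def, mul_assoc]
      rw [Commute, SemiconjBy, ← map_mul, ← h2, map_mul, this, one_mul, map_mul]
    have h2 := Subgroup.relIndex_mul_index hle
    have h3 := Subgroup.relIndex_mul_index hNK
    have h4 : 0 < K.index := Nat.pos_of_ne_zero Subgroup.index_ne_zero_of_finite
    refine Nat.le_of_mul_le_mul_right (c := K.index) ?_ h4
    rw [h3, ← h2]
    exact Nat.mul_le_mul_left _ h1

theorem exists_isMaxAbelianOver_of_mem_irrCharacters {G : Type*} [Group G] [Fintype G]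
    (hmon : IsNormallyMonomial G) {χ : G → ℂ} (hχ : χ ∈ irrCharacters G) :
    ∃ N H : Subgroup G, N.Normal ∧ characterKernel χ = N ∧ IsMaxAbelianOver N H ∧
      χ 1 = H.index ∧ codegree χ = N.relIndex H := by
  obtain ⟨d, ρ, hρ, rfl⟩ := hχ
  obtain ⟨hker, H, hone, hH⟩ := characterKernel_eq_ker hmon hρ
  refine ⟨ρ.ker, H, inferInstance, hker, hH, hone, ?_⟩
  have h1 : (Nat.card G : ℂ) = Nat.card ρ.ker * (ρ.ker.relIndex H * H.index) := by
    rw [← Nat.cast_mul, ← Nat.cast_mul, Subgroup.relIndex_mul_index hH.le, Subgroup.card_mul_index]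
  have h2 : (H.index : ℂ) ≠ 0 := by simpa using Subgroup.index_ne_zero_of_finite
  have h3 : (Nat.card ρ.ker : ℂ) ≠ 0 := Nat.cast_ne_zero.2 Nat.card_pos.ne'
  rw [codegree, hone, hker, h1]
  change (_ / (Nat.card ρ.ker : ℂ)) / _ = _
  field_simp

theorem exists_mem_irrCharacters_of_not_le {G : Type*} [Group G] [Fintype G]
    (hmon : IsNormallyMonomial G) (N M : Subgroup G) [N.Normal] [M.Normal] (hMN : ¬ M ≤ N) :
    ∃ χ ∈ irrCharacters G, (N : Set G) ⊆ characterKernel χ ∧ ¬ (M : Set G) ⊆ characterKernel χ := by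
  obtain ⟨d, ρ, hρ, hN, hM⟩ := Representation.exists_isIrreducible_of_not_le (k := ℂ) N M hMN
  refine ⟨_, ⟨d, ρ, hρ, rfl⟩, ?_⟩
  rw [(characterKernel_eq_ker hmon hρ).1]
  exact ⟨hN, hM⟩

/-! ### Lower central series of finite `p`-groups -/

section LowerCentralSeries

variable {G : Type*} [Group G]

theorem lowerCentralSeries_succ_ne [hG : Group.IsNilpotent G] {j : ℕ}
    (hj : (⊤ : Subgroup G).lowerCentralSeries j ≠ ⊥) :
    (⊤ : Subgroup G).lowerCentralSeries (j + 1) ≠ (⊤ : Subgroup G).lowerCentralSeries j := by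
  intro h
  have hconst : ∀ m, (⊤ : Subgroup G).lowerCentralSeries (j + m) =
      (⊤ : Subgroup G).lowerCentralSeries j := by
    intro m
    induction m with
    | zero => rfl
    | succ m ih => rw [← add_assoc, Subgroup.lowerCentralSeries_succ, ih,
        ← Subgroup.lowerCentralSeries_succ, h]
  obtain ⟨c, hc⟩ := Subgroup.nilpotent_iff_lowerCentralSeries.1 hG
  apply hj
  rw [← hconst c, eq_bot_iff, ← hc]
  exact Subgroup.lowerCentralSeries_antitone _ (Nat.le_add_left c j)

theorem IsPGroup.dvd_relIndex [Finite G] {p : ℕ} [Fact p.Prime] (hG : IsPGroup p G)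
    {H K : Subgroup G} (h : H < K) : p ∣ H.relIndex K := by
  obtain ⟨m, hm⟩ := (hG.to_subgroup K).index (H.subgroupOf K)
  change H.relIndex K = p ^ m at hm
  rw [hm]
  refine dvd_pow_self p fun hm0 => h.not_ge ?_
  rw [hm0, pow_zero, Subgroup.relIndex_eq_one] at hm
  exact hm

/-- If `|G : G'| = p`, the quotient by the next term is central-by-cyclic, hence abelian, and the
series stalls at `G' ≠ ⊥`. -/
theorem IsPGroup.sq_dvd_index_lowerCentralSeries_one [Finite G] {p : ℕ} [Fact p.Prime]
    (hG : IsPGroup p G) (h : (⊤ : Subgroup G).lowerCentralSeries 1 ≠ ⊥) :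
    p ^ 2 ∣ ((⊤ : Subgroup G).lowerCentralSeries 1).index := by
  have hnil : Group.IsNilpotent G := hG.isNilpotent
  obtain ⟨m, hm⟩ := hG.index ((⊤ : Subgroup G).lowerCentralSeries 1)
  rw [hm]
  refine pow_dvd_pow p ?_
  by_contra! hm2
  obtain rfl | rfl : m = 0 ∨ m = 1 := by omega
  · rw [pow_zero, Subgroup.index_eq_one] at hm
    have h0 : (⊤ : Subgroup G).lowerCentralSeries 0 ≠ ⊥ := fun h0 => h
      (le_bot_iff.1 (h0 ▸ Subgroup.lowerCentralSeries_antitone _ (Nat.zero_le 1)))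
    exact lowerCentralSeries_succ_ne h0 hm
  · refine lowerCentralSeries_succ_ne h (le_antisymm
      (Subgroup.lowerCentralSeries_antitone _ (Nat.le_succ 1)) ?_)
    set A := (⊤ : Subgroup G).lowerCentralSeries 1 with hA
    set B := (⊤ : Subgroup G).lowerCentralSeries (1 + 1) with hB
    have hBA : B ≤ A := Subgroup.lowerCentralSeries_antitone _ (Nat.le_succ 1)
    have hcyc : IsCyclic (G ⧸ A) := by
      refine isCyclic_of_prime_card (p := p) ?_
      rw [← Subgroup.index_eq_card, hm, pow_one]
    let f : G ⧸ B →* G ⧸ A := QuotientGroup.map B A (MonoidHom.id G) hBA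
    have hf : f.ker ≤ Subgroup.center (G ⧸ B) := by
      intro x
      induction x using QuotientGroup.induction_on with
      | H x =>
        intro hx
        have hxA : x ∈ A := (QuotientGroup.eq_one_iff x).1 hx
        rw [Subgroup.mem_center_iff]
        intro y
        induction y using QuotientGroup.induction_on with
        | H y =>
          rw [← QuotientGroup.mk_mul, ← QuotientGroup.mk_mul, eq_comm, QuotientGroup.eq_iff_div_mem]
          have : x * y / (y * x) = ⁅x, y⁆ := by
            rw [commutatorElement_def, div_eq_mul_inv, mul_inv_rev, mul_assoc (x * y)]
          rw [this]
          exact Subgroup.commutator_mem_commutator hxA (Subgroup.mem_top y)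
    change ⁅(⊤ : Subgroup G), ⊤⁆ ≤ B
    rw [Subgroup.commutator_le]
    intro a _ b _
    rw [← QuotientGroup.eq_one_iff, ← QuotientGroup.mk'_apply, map_commutatorElement,
      commutatorElement_eq_one_iff_mul_comm]
    exact (f.isMulCommutative_of_isCyclic_of_ker_le_center hf).is_comm.comm _ _

theorem IsPGroup.pow_dvd_index_lowerCentralSeries [Finite G] {p : ℕ} [Fact p.Prime]
    (hG : IsPGroup p G) (i : ℕ) (h : (⊤ : Subgroup G).lowerCentralSeries (i + 1) ≠ ⊥) :
    p ^ (i + 2) ∣ ((⊤ : Subgroup G).lowerCentralSeries (i + 1)).index := by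
  have hnil : Group.IsNilpotent G := hG.isNilpotent
  induction i with
  | zero => exact hG.sq_dvd_index_lowerCentralSeries_one h
  | succ i ih =>
    have hle := Subgroup.lowerCentralSeries_antitone (⊤ : Subgroup G) (Nat.le_succ (i + 1))
    have h' : (⊤ : Subgroup G).lowerCentralSeries (i + 1) ≠ ⊥ :=
      fun h' => h (le_bot_iff.1 (h' ▸ hle))
    rw [← Subgroup.relIndex_mul_index hle, show i + 1 + 2 = 1 + (i + 2) by ring, pow_add, pow_one]
    exact mul_dvd_mul (hG.dvd_relIndex (hle.lt_of_ne (lowerCentralSeries_succ_ne h'))) (ih h')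

theorem IsPGroup.pow_dvd_card_of_lowerCentralSeries_ne_bot [Finite G] {p : ℕ} [Fact p.Prime]
    (hG : IsPGroup p G) (i : ℕ) (h : (⊤ : Subgroup G).lowerCentralSeries (i + 1) ≠ ⊥) :
    p ^ (i + 3) ∣ Nat.card G := by
  rw [← Subgroup.index_mul_card ((⊤ : Subgroup G).lowerCentralSeries (i + 1)), pow_succ]
  refine mul_dvd_mul (hG.pow_dvd_index_lowerCentralSeries i h) ?_
  rw [← Subgroup.relIndex_bot_left]
  exact hG.dvd_relIndex (bot_lt_iff_ne_bot.2 h)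

theorem IsPGroup.pow_dvd_index_of_not_lowerCentralSeries_le [Finite G] {p : ℕ} [Fact p.Prime]
    (hG : IsPGroup p G) (N : Subgroup G) [N.Normal] (i : ℕ)
    (h : ¬ (⊤ : Subgroup G).lowerCentralSeries (i + 1) ≤ N) : p ^ (i + 3) ∣ N.index := by
  rw [Subgroup.index_eq_card]
  refine (hG.to_quotient N).pow_dvd_card_of_lowerCentralSeries_ne_bot i fun hbot => h ?_
  have h1 := Subgroup.map_lowerCentralSeries (⊤ : Subgroup G) (QuotientGroup.mk' N) (i + 1)
  rw [Subgroup.map_top_of_surjective _ (QuotientGroup.mk'_surjective N), hbot,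
    Subgroup.map_eq_bot_iff, QuotientGroup.ker_mk'] at h1
  exact h1

end LowerCentralSeries

/-! ### Normal subgroups of groups of maximal class -/

section MaximalClass

theorem lowerCentralSeries_ne_bot_of_lt {G : Type*} [Group G] {n : ℕ} [Group.IsNilpotent G]
    (hclass : Group.nilpotencyClass G = n - 1) {k : ℕ} (hk : k < n - 1) :
    (⊤ : Subgroup G).lowerCentralSeries k ≠ ⊥ := by
  rw [Ne, Subgroup.lowerCentralSeries_eq_bot_iff_nilpotencyClass_le]
  omega

variable {G : Type*} [Group G] [Finite G] {p n : ℕ} [Fact p.Prime]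

theorem pow_dvd_card_lowerCentralSeries (hcard : Nat.card G = p ^ n)
    (hclass : Group.nilpotencyClass G = n - 1) (t : ℕ) (ht : t ≤ n - 1) :
    p ^ t ∣ Nat.card ((⊤ : Subgroup G).lowerCentralSeries (n - 1 - t)) := by
  have hG : IsPGroup p G := .of_card hcard
  have hnil : Group.IsNilpotent G := hG.isNilpotent
  induction t with
  | zero => simp
  | succ t ih =>
    have hk : n - 1 - t = n - 1 - (t + 1) + 1 := by omega
    have hlt := (Subgroup.lowerCentralSeries_antitone (⊤ : Subgroup G)
      (Nat.le_succ (n - 1 - (t + 1)))).lt_of_ne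
        (lowerCentralSeries_succ_ne (lowerCentralSeries_ne_bot_of_lt hclass (by omega)))
    have h1 := Subgroup.relIndex_mul_relIndex ⊥ _ _ bot_le hlt.le
    rw [Subgroup.relIndex_bot_left, Subgroup.relIndex_bot_left] at h1
    rw [← h1, pow_succ]
    refine mul_dvd_mul ?_ (hG.dvd_relIndex hlt)
    have := ih (by omega)
    rwa [hk] at this

/-- The lower bounds for the index and for the order multiply to `p ^ n`, so both are equalities. -/
theorem index_lowerCentralSeries (hn : 3 ≤ n) (hcard : Nat.card G = p ^ n)
    (hclass : Group.nilpotencyClass G = n - 1) {k : ℕ} (hk1 : 1 ≤ k) (hk : k ≤ n - 1) :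
    ((⊤ : Subgroup G).lowerCentralSeries k).index = p ^ (k + 1) := by
  have hp : p.Prime := Fact.out
  have hG : IsPGroup p G := .of_card hcard
  have hnil : Group.IsNilpotent G := hG.isNilpotent
  have h1 : p ^ (k + 1) ∣ ((⊤ : Subgroup G).lowerCentralSeries k).index := by
    obtain rfl | ⟨i, rfl⟩ : k = 1 ∨ ∃ i, k = i + 1 + 1 := by
      rcases k with _ | _ | i
      · omega
      · exact .inl rfl
      · exact .inr ⟨i, rfl⟩
    · exact hG.sq_dvd_index_lowerCentralSeries_one
        (lowerCentralSeries_ne_bot_of_lt hclass (by omega))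
    · refine hG.pow_dvd_index_of_not_lowerCentralSeries_le _ i fun hle => ?_
      refine lowerCentralSeries_succ_ne
        (lowerCentralSeries_ne_bot_of_lt (k := i + 1) hclass (by omega)) (le_antisymm ?_ hle)
      exact Subgroup.lowerCentralSeries_antitone _ (Nat.le_succ _)
  have h2 := pow_dvd_card_lowerCentralSeries hcard hclass (n - 1 - k) (by omega)
  rw [Nat.sub_sub_self hk] at h2
  have h3 := Subgroup.card_mul_index ((⊤ : Subgroup G).lowerCentralSeries k)
  refine Nat.dvd_antisymm ?_ h1
  obtain ⟨u, hu⟩ := h2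
  refine Dvd.intro u (Nat.eq_of_mul_eq_mul_left (pow_pos hp.pos (n - 1 - k)) ?_)
  rw [← pow_add, show n - 1 - k + (k + 1) = n by omega, ← hcard, ← h3, hu]
  ring

/-- For the least `k` with `γ k ≤ N`, the class of `G / N` forces `p ^ (k + 1) ∣ |G : N|`. As `|G :
γ k| = p ^ (k + 1)`, the two subgroups coincide. -/
theorem exists_eq_lowerCentralSeries (hn : 3 ≤ n) (hcard : Nat.card G = p ^ n)
    (hclass : Group.nilpotencyClass G = n - 1) (N : Subgroup G) [N.Normal]
    (hN : ¬ (⊤ : Subgroup G).lowerCentralSeries 1 ≤ N) :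
    ∃ k, 2 ≤ k ∧ k ≤ n - 1 ∧ N = (⊤ : Subgroup G).lowerCentralSeries k := by
  classical
  have hp : p.Prime := Fact.out
  have hG : IsPGroup p G := .of_card hcard
  have hnil : Group.IsNilpotent G := hG.isNilpotent
  have hlast : (⊤ : Subgroup G).lowerCentralSeries (n - 1) ≤ N := by
    rw [Subgroup.lowerCentralSeries_eq_bot_iff_nilpotencyClass_le.2 hclass.le]
    exact bot_le
  have hex : ∃ k, (⊤ : Subgroup G).lowerCentralSeries k ≤ N := ⟨_, hlast⟩
  have hk2 : 2 ≤ Nat.find hex := by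
    by_contra! hlt
    exact hN ((Subgroup.lowerCentralSeries_antitone _ (by omega)).trans (Nat.find_spec hex))
  obtain ⟨i, hi⟩ := Nat.exists_eq_add_of_le' hk2
  have hkn : Nat.find hex ≤ n - 1 := Nat.find_min' hex hlast
  refine ⟨Nat.find hex, hk2, hkn, (Subgroup.eq_of_le_of_card_ge (Nat.find_spec hex) ?_).symm⟩
  have h1 := hG.pow_dvd_index_of_not_lowerCentralSeries_le N i (Nat.find_min hex (by omega))
  have h2 := index_lowerCentralSeries hn hcard hclass (by omega) hkn
  have h3 := Subgroup.card_mul_index N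
  have h4 := Subgroup.card_mul_index ((⊤ : Subgroup G).lowerCentralSeries (Nat.find hex))
  rw [h2] at h4
  have h5 := Nat.le_of_dvd (Nat.pos_of_ne_zero Subgroup.index_ne_zero_of_finite) h1
  rw [show i + 3 = Nat.find hex + 1 by omega] at h5
  refine Nat.le_of_mul_le_mul_right (c := p ^ (Nat.find hex + 1)) ?_ (pow_pos hp.pos _)
  rw [h4, ← h3]
  exact Nat.mul_le_mul_left _ h5

end MaximalClass

/-! ### Comparing maximal abelian sections, and small codegrees -/

theorem IsMaxAbelianOver.relIndex_eq {G : Type*} [Group G] {N H K : Subgroup G}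
    (hH : IsMaxAbelianOver N H) (hK : IsMaxAbelianOver N K) : N.relIndex H = N.relIndex K :=
  le_antisymm (hK.relIndex_le H hH.le hH.commutator_le) (hH.relIndex_le K hK.le hK.commutator_le)

/-- The image `HN / N` is abelian, so its order is at most that of `K / N`. This yields `e (k + 1) ≤
e k + 1`. -/
theorem IsMaxAbelianOver.relIndex_le_mul {G : Type*} [Group G] [Finite G] {M N H K : Subgroup G}
    [N.Normal] (hMN : M ≤ N) (hH : IsMaxAbelianOver M H) (hK : IsMaxAbelianOver N K) :
    M.relIndex H ≤ M.relIndex N * N.relIndex K := by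
  have hHN : H.Normal := hH.normal
  have hcomm : ⁅H ⊔ N, H ⊔ N⁆ ≤ N := by
    rw [← QuotientGroup.ker_mk' N, ← Subgroup.map_eq_bot_iff, Subgroup.map_commutator,
      Subgroup.map_sup, QuotientGroup.ker_mk', (Subgroup.map_eq_bot_iff N).2
        (QuotientGroup.ker_mk' N).ge, sup_bot_eq, ← Subgroup.map_commutator,
      Subgroup.map_eq_bot_iff, QuotientGroup.ker_mk']
    exact hH.commutator_le.trans hMN
  calc M.relIndex H ≤ M.relIndex (H ⊔ N) :=
        Nat.le_of_dvd (Nat.pos_of_ne_zero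
          (Subgroup.index_ne_zero_of_finite (H := M.subgroupOf (H ⊔ N))))
          ⟨_, (Subgroup.relIndex_mul_relIndex M H (H ⊔ N) hH.le le_sup_left).symm⟩
    _ = M.relIndex N * N.relIndex (H ⊔ N) :=
        (Subgroup.relIndex_mul_relIndex M N (H ⊔ N) hMN le_sup_right).symm
    _ ≤ M.relIndex N * N.relIndex K :=
        Nat.mul_le_mul_left _ (hK.relIndex_le _ le_sup_right hcomm)

theorem exists_abelian_section_of_sq_dvd_index {G : Type*} [Group G] [Finite G] {p : ℕ}
    [Fact p.Prime] (N : Subgroup G) [N.Normal] (h : p ^ 2 ∣ N.index) :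
    ∃ K : Subgroup G, N ≤ K ∧ ⁅K, K⁆ ≤ N ∧ N.relIndex K = p ^ 2 := by
  rw [Subgroup.index_eq_card] at h
  obtain ⟨L, hL⟩ := Sylow.exists_subgroup_card_pow_prime p h
  have hmap : (L.comap (QuotientGroup.mk' N)).map (QuotientGroup.mk' N) = L :=
    Subgroup.map_comap_eq_self_of_surjective (QuotientGroup.mk'_surjective N) L
  have hle : N ≤ L.comap (QuotientGroup.mk' N) := QuotientGroup.le_comap_mk' N L
  refine ⟨L.comap (QuotientGroup.mk' N), hle, ?_, ?_⟩
  · have hcomm := (IsPGroup.isMulCommutative_of_card_eq_prime_sq hL).is_comm.comm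
    suffices h0 : ⁅L.comap (QuotientGroup.mk' N), L.comap (QuotientGroup.mk' N)⁆.map
        (QuotientGroup.mk' N) = ⊥ by
      rwa [Subgroup.map_eq_bot_iff, QuotientGroup.ker_mk'] at h0
    rw [Subgroup.map_commutator, hmap, eq_bot_iff, Subgroup.commutator_le]
    intro a ha b hb
    rw [Subgroup.mem_bot, commutatorElement_eq_one_iff_mul_comm]
    exact congr(($(hcomm ⟨a, ha⟩ ⟨b, hb⟩) : G ⧸ N))
  · refine Nat.eq_of_mul_eq_mul_right (Nat.pos_of_ne_zero (Subgroup.index_ne_zero_of_finite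
      (H := L.comap (QuotientGroup.mk' N)))) ?_
    rw [Subgroup.relIndex_mul_index hle,
      Subgroup.index_comap_of_surjective L (QuotientGroup.mk'_surjective N), ← hL,
      Subgroup.card_mul_index, Subgroup.index_eq_card]

theorem exists_mem_irrCharacters_codegree_eq_one {G : Type*} [Group G] [Fintype G] :
    ∃ χ ∈ irrCharacters G, codegree χ = 1 := by
  have hchar : ∀ g, (Representation.trivial ℂ G (Fin 1 → ℂ)).character g = 1 := by
    intro g
    have : Representation.trivial ℂ G (Fin 1 → ℂ) g = 1 := rfl
    rw [Representation.character, this, LinearMap.trace_one]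
    simp
  refine ⟨_, ⟨1, Representation.trivial ℂ G (Fin 1 → ℂ), ?_, rfl⟩, ?_⟩
  · rw [Representation.isIrreducible_iff_forall_invariant]
    have : IsSimpleModule ℂ (Fin 1 → ℂ) := isSimpleModule_iff_finrank_eq_one.2 (by simp)
    exact ⟨inferInstance, fun W _ => eq_bot_or_eq_top W⟩
  · have : characterKernel (Representation.trivial ℂ G (Fin 1 → ℂ)).character = Set.univ :=
      Set.eq_univ_of_forall fun g => (hchar g).trans (hchar 1).symm
    rw [codegree, hchar, this, Nat.card_univ, div_one, div_self]
    exact Nat.cast_ne_zero.2 Nat.card_pos.ne'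

/-! ### Characters with prescribed kernel in maximal class -/

section MaximalClass

variable {G : Type*} [Group G] [Fintype G] {p n : ℕ} [Fact p.Prime]

theorem exists_mem_irrCharacters_codegree_eq_prime (hn : 3 ≤ n) (hcard : Nat.card G = p ^ n)
    (hclass : Group.nilpotencyClass G = n - 1) (hmon : IsNormallyMonomial G) :
    ∃ χ ∈ irrCharacters G, codegree χ = p := by
  have hp : p.Prime := Fact.out
  obtain ⟨M, hM⟩ := Sylow.exists_subgroup_card_pow_prime (G := G) p (n := n - 1)
    (hcard ▸ pow_dvd_pow p (Nat.sub_le n 1))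
  have hMi : M.index = p := by
    refine Nat.eq_of_mul_eq_mul_left (pow_pos hp.pos (n - 1)) ?_
    rw [← hM, M.card_mul_index, hM, hcard, ← pow_succ]
    congr 1
    omega
  have hMn : M.Normal := Subgroup.normal_of_index_eq_minFac_card (by
    rw [hcard, hp.pow_minFac (by omega), hMi])
  obtain ⟨χ, hχ, hMχ, hχ1⟩ := exists_mem_irrCharacters_of_not_le hmon M ⊤ (by
    intro h
    rw [top_le_iff.1 h, Subgroup.index_top] at hMi
    exact hp.one_lt.ne hMi)
  obtain ⟨N, H, hN, hker, hH, -, hcod⟩ := exists_isMaxAbelianOver_of_mem_irrCharacters hmon hχ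
  rw [hker] at hMχ hχ1
  have hNi : N.index = p := by
    have h1 : N.index ∣ p := hMi ▸ Subgroup.index_dvd_of_le hMχ
    refine ((Nat.dvd_prime hp).1 h1).resolve_left fun h => hχ1 ?_
    rw [Subgroup.index_eq_one.1 h]
  -- Otherwise `N` is a term of index at least `p ^ 3`.
  have hcomm : (⊤ : Subgroup G).lowerCentralSeries 1 ≤ N := by
    by_contra h
    obtain ⟨k, hk2, hkn, rfl⟩ := exists_eq_lowerCentralSeries hn hcard hclass N h
    rw [index_lowerCentralSeries hn hcard hclass (by omega) hkn] at hNi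
    have := Nat.pow_right_injective hp.two_le (hNi.trans (pow_one p).symm)
    omega
  have h1 := hH.relIndex_le ⊤ le_top hcomm
  have h2 := Subgroup.relIndex_mul_index hH.le
  rw [Subgroup.relIndex_top_right, hNi] at h1
  refine ⟨χ, hχ, ?_⟩
  rw [hcod, le_antisymm (Nat.le_of_dvd hp.pos ⟨_, (h2.trans hNi).symm⟩) h1]

/-- A character trivial on `γ k` but not on `γ (k - 1)` has kernel exactly `γ k`, because its kernel
is itself a term of the series. -/
theorem exists_mem_irrCharacters_characterKernel_eq_lowerCentralSeries (hn : 3 ≤ n)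
    (hcard : Nat.card G = p ^ n) (hclass : Group.nilpotencyClass G = n - 1)
    (hmon : IsNormallyMonomial G) {k : ℕ} (hk2 : 2 ≤ k) (hk : k ≤ n - 1) :
    ∃ (H : Subgroup G) (χ : G → ℂ), χ ∈ irrCharacters G ∧
      IsMaxAbelianOver ((⊤ : Subgroup G).lowerCentralSeries k) H ∧ χ 1 = H.index ∧
      codegree χ = ((⊤ : Subgroup G).lowerCentralSeries k).relIndex H := by
  have hnil : Group.IsNilpotent G := (IsPGroup.of_card hcard).isNilpotent
  have hanti := Subgroup.lowerCentralSeries_antitone (⊤ : Subgroup G)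
  obtain ⟨j, rfl⟩ := Nat.exists_eq_add_of_le' (show 1 ≤ k by omega)
  obtain ⟨χ, hχ, hle, hnle⟩ := exists_mem_irrCharacters_of_not_le hmon
    ((⊤ : Subgroup G).lowerCentralSeries (j + 1)) ((⊤ : Subgroup G).lowerCentralSeries j)
    fun h => lowerCentralSeries_succ_ne (lowerCentralSeries_ne_bot_of_lt hclass (by omega))
      (le_antisymm (hanti (Nat.le_succ j)) h)
  obtain ⟨N, H, hN, hker, hH, hone, hcod⟩ := exists_isMaxAbelianOver_of_mem_irrCharacters hmon hχ
  rw [hker] at hle hnle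
  obtain ⟨i, hi2, hin, rfl⟩ := exists_eq_lowerCentralSeries hn hcard hclass N
    fun h => hnle ((hanti (by omega)).trans h)
  have hij : j + 1 ≤ i := by
    by_contra! hlt
    exact hnle (hanti (by omega))
  have heq := le_antisymm (hanti hij) hle
  rw [heq] at hH hcod
  exact ⟨H, χ, hχ, hH, hone, hcod⟩

/-- The quotient has order `p ^ 3` and is nonabelian, while any subgroup of order `p ^ 2` is
abelian. -/
theorem IsMaxAbelianOver.relIndex_lowerCentralSeries_two (hn : 3 ≤ n)
    (hcard : Nat.card G = p ^ n) (hclass : Group.nilpotencyClass G = n - 1) {H : Subgroup G}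
    (hH : IsMaxAbelianOver ((⊤ : Subgroup G).lowerCentralSeries 2) H) :
    ((⊤ : Subgroup G).lowerCentralSeries 2).relIndex H = p ^ 2 := by
  have hp : p.Prime := Fact.out
  have hnil : Group.IsNilpotent G := (IsPGroup.of_card hcard).isNilpotent
  have hidx := index_lowerCentralSeries hn hcard hclass (k := 2) (by omega) (by omega)
  obtain ⟨K, hK, hK', hKi⟩ := exists_abelian_section_of_sq_dvd_index (p := p)
    ((⊤ : Subgroup G).lowerCentralSeries 2) (hidx ▸ pow_dvd_pow p (by omega))
  have h1 := hH.relIndex_le K hK hK'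
  have h2 := Subgroup.relIndex_mul_index hH.le
  rw [hidx] at h2
  obtain ⟨a, ha, ha'⟩ := (Nat.dvd_prime_pow hp).1 ⟨_, h2.symm⟩
  rw [hKi, ha', Nat.pow_le_pow_iff_right hp.one_lt] at h1
  rw [ha']
  congr 1
  refine le_antisymm ?_ h1
  by_contra! h3
  obtain rfl : a = 3 := by omega
  have h4 : H.index = 1 := by
    rw [ha'] at h2
    exact Nat.eq_of_mul_eq_mul_left (pow_pos hp.pos _) (h2.trans (mul_one _).symm)
  have h5 := hH.commutator_le
  rw [Subgroup.index_eq_one.1 h4] at h5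
  exact lowerCentralSeries_succ_ne (lowerCentralSeries_ne_bot_of_lt (k := 1) hclass (by omega))
    (le_antisymm (Subgroup.lowerCentralSeries_antitone _ (Nat.le_succ 1)) h5)

end MaximalClass

/-! ### Discrete intermediate values and the main theorem -/

theorem Nat.exists_eq_of_le_of_forall_succ_le (e : ℕ → ℕ) {a m i : ℕ} (ham : a ≤ m)
    (hstep : ∀ k, a ≤ k → k < m → e (k + 1) ≤ e k + 1) (ha : e a ≤ i) (hm : i ≤ e m) :
    ∃ k, a ≤ k ∧ k ≤ m ∧ e k = i := by
  induction m, ham using Nat.le_induction with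
  | base => exact ⟨a, le_rfl, le_rfl, le_antisymm ha hm⟩
  | succ m ham ih =>
    rcases hm.eq_or_lt with h | h
    · exact ⟨m + 1, by omega, le_rfl, h.symm⟩
    · have := hstep m ham (by omega)
      obtain ⟨k, hk, hkm, hki⟩ := ih (fun k hk hkm => hstep k hk (by omega)) (by omega)
      exact ⟨k, hk, by omega, hki⟩

theorem theoremD {G : Type*} [Group G] [Fintype G] (p n : ℕ) (hp : p.Prime)
    (hn : 3 ≤ n) (hcard : Nat.card G = p ^ n)
    (hnil : Group.IsNilpotent G) (hclass : Group.nilpotencyClass G = n - 1)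
    (hmon : IsNormallyMonomial G) :
    ∃ b c : ℕ, IsGreatest (characterDegrees G) (p ^ b) ∧ (n : ℤ) - (b : ℤ) ≤ (c : ℤ) ∧
      codegrees G = {z : ℂ | ∃ i : ℕ, i ≤ c ∧ z = (p : ℂ) ^ i} := by
  have : Fact p.Prime := ⟨hp⟩
  have hG : IsPGroup p G := .of_card hcard
  let γ : ℕ → Subgroup G := (⊤ : Subgroup G).lowerCentralSeries
  -- The range conditions stand after `∃ e` so that `choose` gives a total function; its values
  -- outside the range play no role.
  have hγ : ∀ k, ∃ e : ℕ, 2 ≤ k → k ≤ n - 1 → ∃ (H : Subgroup G) (χ : G → ℂ),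
      χ ∈ irrCharacters G ∧ IsMaxAbelianOver (γ k) H ∧ χ 1 = H.index ∧
      (γ k).relIndex H = p ^ e ∧ codegree χ = (p : ℂ) ^ e := by
    intro k
    by_cases hk : 2 ≤ k ∧ k ≤ n - 1
    · obtain ⟨H, χ, hχ, hH, hone, hcod⟩ :=
        exists_mem_irrCharacters_characterKernel_eq_lowerCentralSeries hn hcard hclass hmon
          hk.1 hk.2
      obtain ⟨e, he⟩ := (hG.to_subgroup H).index ((γ k).subgroupOf H)
      exact ⟨e, fun _ _ => ⟨H, χ, hχ, hH, hone, he, hcod.trans (by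
        rw [show ((⊤ : Subgroup G).lowerCentralSeries k).relIndex H = p ^ e from he,
          Nat.cast_pow])⟩⟩
    · exact ⟨0, fun h2 h => absurd ⟨h2, h⟩ hk⟩
  choose e he using hγ
  have he2 : e 2 = 2 := by
    obtain ⟨H, χ, -, hH, -, hrel, -⟩ := he 2 le_rfl (by omega)
    exact Nat.pow_right_injective hp.two_le
      (hrel.symm.trans (hH.relIndex_lowerCentralSeries_two hn hcard hclass))
  have hstep : ∀ k, 2 ≤ k → k < n - 1 → e (k + 1) ≤ e k + 1 := by
    intro k hk2 hk
    obtain ⟨H, -, -, hH, -, hHrel, -⟩ := he (k + 1) (by omega) (by omega)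
    obtain ⟨K, -, -, hK, -, hKrel, -⟩ := he k hk2 (by omega)
    have hle : γ (k + 1) ≤ γ k := Subgroup.lowerCentralSeries_antitone _ (Nat.le_succ k)
    have hrel : (γ (k + 1)).relIndex (γ k) = p := by
      have h1 := Subgroup.relIndex_mul_index hle
      rw [index_lowerCentralSeries hn hcard hclass (by omega) (by omega),
        index_lowerCentralSeries hn hcard hclass (by omega) (by omega), pow_succ' p (k + 1)] at h1
      exact Nat.eq_of_mul_eq_mul_right (pow_pos hp.pos _) h1
    have hkN : (γ k).Normal := by
      change ((⊤ : Subgroup G).lowerCentralSeries k).Normal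
      infer_instance
    have h1 := hH.relIndex_le_mul hle hK
    rw [hrel, hHrel, hKrel, ← pow_succ', Nat.pow_le_pow_iff_right hp.one_lt] at h1
    exact h1
  let c := (Finset.Icc 2 (n - 1)).sup e
  have hec : ∀ k, 2 ≤ k → k ≤ n - 1 → e k ≤ c := fun k hk2 hk =>
    Finset.le_sup (f := e) (Finset.mem_Icc.2 ⟨hk2, hk⟩)
  have hc2 : 2 ≤ c := he2 ▸ hec 2 le_rfl (by omega)
  have hdeg : ∀ d ∈ characterDegrees G, ∃ a ≤ n, d = p ^ a := by
    rintro d ⟨χ, hχ, hd⟩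
    obtain ⟨N, H, -, -, -, hone, -⟩ := exists_isMaxAbelianOver_of_mem_irrCharacters hmon hχ
    have : H.index = d := by exact_mod_cast hone.symm.trans hd
    exact (Nat.dvd_prime_pow hp).1 (this ▸ hcard ▸ H.index_dvd_card)
  have hfin : (characterDegrees G).Finite := by
    refine (Set.finite_Iic (p ^ n)).subset fun d hd => ?_
    obtain ⟨a, ha, rfl⟩ := hdeg d hd
    exact Nat.pow_le_pow_right hp.pos ha
  obtain ⟨H, χ, hχ, hH, hone, hrel, -⟩ := he (n - 1) (by omega) le_rfl
  have hHdeg : H.index ∈ characterDegrees G := ⟨χ, hχ, hone⟩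
  obtain ⟨m, hm⟩ := hfin.exists_maximal ⟨_, hHdeg⟩
  obtain ⟨b, hb, rfl⟩ := hdeg m hm.1
  have hgreatest : IsGreatest (characterDegrees G) (p ^ b) :=
    ⟨hm.1, fun d hd => (le_total d (p ^ b)).elim id fun h => hm.2 hd h⟩
  refine ⟨b, c, hgreatest, ?_, ?_⟩
  -- For `k = n - 1` the kernel has index `p ^ n`, so `e (n - 1) + a = n` with `a ≤ b`.
  · obtain ⟨a, -, ha⟩ := hdeg _ hHdeg
    have hab := hgreatest.2 hHdeg
    rw [ha, Nat.pow_le_pow_iff_right hp.one_lt] at hab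
    have h1 := Subgroup.relIndex_mul_index hH.le
    rw [hrel, ha, index_lowerCentralSeries hn hcard hclass (by omega) le_rfl, ← pow_add] at h1
    have h2 := Nat.pow_right_injective hp.two_le h1
    have h3 := hec (n - 1) (by omega) le_rfl
    omega
  · apply Set.Subset.antisymm
    · rintro _ ⟨χ, hχ, rfl⟩
      obtain ⟨N, H, hN, -, hH, -, hcod⟩ := exists_isMaxAbelianOver_of_mem_irrCharacters hmon hχ
      by_cases hle : (⊤ : Subgroup G).lowerCentralSeries 1 ≤ N
      · have h1 : N.relIndex H ∣ p ^ 2 := by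
          rw [← index_lowerCentralSeries hn hcard hclass le_rfl (by omega)]
          exact Dvd.dvd.trans ⟨_, (Subgroup.relIndex_mul_index hH.le).symm⟩
            (Subgroup.index_dvd_of_le hle)
        obtain ⟨i, hi, hi'⟩ := (Nat.dvd_prime_pow hp).1 h1
        exact ⟨i, hi.trans hc2, by rw [hcod, hi', Nat.cast_pow]⟩
      · obtain ⟨k, hk2, hk, rfl⟩ := exists_eq_lowerCentralSeries hn hcard hclass N hle
        obtain ⟨K, -, -, hK, -, hrel, -⟩ := he k hk2 hk
        exact ⟨e k, hec k hk2 hk, by rw [hcod, hH.relIndex_eq hK, hrel, Nat.cast_pow]⟩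
    · rintro _ ⟨i, hi, rfl⟩
      rcases lt_or_ge i 2 with hi2 | hi2
      · interval_cases i
        · rw [pow_zero]
          exact exists_mem_irrCharacters_codegree_eq_one
        · rw [pow_one]
          exact exists_mem_irrCharacters_codegree_eq_prime hn hcard hclass hmon
      -- Here `m` is where `e` attains `c`; between 2 and `m` no value is skipped.
      · obtain ⟨m, hm, hmc⟩ := Finset.exists_mem_eq_sup (Finset.Icc 2 (n - 1))
          ⟨2, Finset.mem_Icc.2 ⟨le_rfl, by omega⟩⟩ e
        rw [Finset.mem_Icc] at hm
        obtain ⟨k, hk2, hkm, rfl⟩ := Nat.exists_eq_of_le_of_forall_succ_le e hm.1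
          (fun k hk hkm => hstep k hk (by omega)) (he2.le.trans hi2) (hi.trans hmc.le)
        obtain ⟨-, χ, hχ, -, -, -, hcod⟩ := he k hk2 (by omega)
        exact ⟨χ, hχ, hcod⟩
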